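/- For a group $G$, let $G\otimes G$ be the nonabelian tensor square: the group generated by symbols $x\otimes y$ $(x,y\in G)$ subject to $xy\otimes z=({}^xy\otimes{}^xz)(x\otimes z)$ and $x\otimes zt=(x\otimes z)({}^zx\otimes{}^zt)$ for all $x,y,z,t\in G$, where ${}^xy=xyx^{-1}$. Put $\nabla(G)=\langle x\otimes x\mid x\in G\rangle$ and $G\wedge G=(G\otimes G)/\nabla(G)$. Let $J_2(G)$ be the kernel of $\kappa:G\otimes G\to[G,G]$, $x\otimes y\mapsto[x,y]=xyx^{-1}y^{-1}$, and let $M(G)$ (the Schur multiplier $H_2(G)$) be the kernel of the induced map $\kappa':G\wedge G\to[G,G]$. Let $h$ denote the Hirsch length, i.e. the number of infinite cyclic factors in a finite subnormal series whose factors are infinite cyclic or periodic, and write $f(h(G))=h(G\otimes G)-h(G)$. For a prime $p$ let $G_p=C_p\ltimes\mathbb{Z}^{p-1}$ be the crystallographic group of holonomy $p$, in which the generator $t$ of $C_p$ acts on the standard basis $a_1,\dots,a_{p-1}$ of $\mathbb{Z}^{p-1}$ by $t^{-1}a_it=a_{i+1}$ for $1\le i\le p-2$ and $t^{-1}a_{p-1}t=a_1^{-1}\cdots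 a_{p-1}^{-1}$. Assume that $M(G_p)\cong\mathbb{Z}^{(p-1)/2}$ for every odd prime $p$. Then for every odd prime $p$ the Hirsch lengths of $G_p$ and $G_p\otimes G_p$ are finite, $h(G_p)=p-1$, and $$f(h(G_p))=\tfrac{p-1}{2}=h(J_2(G_p))=h(M(G_p)).$$ In particular $f(h(G_p))$ has linear growth: $f(h(G_p))=\tfrac12\,h(G_p)$ for every odd prime $p$. -/

import Mathlib

/-! ### The nonabelian tensor square -/

/-- Defining relators of the nonabelian tensor square, with `ˣy = x y x⁻¹`; the free generator
`(x, y)` stands for the symbol `x ⊗ y`: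
`xy ⊗ z = (ˣy ⊗ ˣz)(x ⊗ z)` and `x ⊗ zt = (x ⊗ z)(ᶻx ⊗ ᶻt)`. -/
def tensorSquareRels (G : Type*) [Group G] : Set (FreeGroup (G × G)) :=
  {r | ∃ x y z : G, r = FreeGroup.of (x * y, z) *
      (FreeGroup.of (x * y * x⁻¹, x * z * x⁻¹) * FreeGroup.of (x, z))⁻¹} ∪
  {r | ∃ x z t : G, r = FreeGroup.of (x, z * t) *
      (FreeGroup.of (x, z) * FreeGroup.of (z * x * z⁻¹, z * t * z⁻¹))⁻¹}

/-- The nonabelian tensor square `G ⊗ G`. -/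
abbrev TensorSquare (G : Type*) [Group G] : Type _ := PresentedGroup (tensorSquareRels G)

namespace TensorSquare

variable {G : Type*} [Group G]

/-- The generator `x ⊗ y`. -/
def tmul (x y : G) : TensorSquare G := PresentedGroup.of (x, y)

theorem mul_tmul (x y z : G) :
    tmul (x * y) z = tmul (x * y * x⁻¹) (x * z * x⁻¹) * tmul x z := by
  have h : (PresentedGroup.mk (tensorSquareRels G)) (FreeGroup.of (x * y, z) *
      (FreeGroup.of (x * y * x⁻¹, x * z * x⁻¹) * FreeGroup.of (x, z))⁻¹) = 1 :=
    PresentedGroup.one_of_mem (Or.inl ⟨x, y, z, rfl⟩)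
  rw [map_mul, map_inv, mul_inv_eq_one, map_mul] at h
  exact h

theorem tmul_mul (x z t : G) :
    tmul x (z * t) = tmul x z * tmul (z * x * z⁻¹) (z * t * z⁻¹) := by
  have h : (PresentedGroup.mk (tensorSquareRels G)) (FreeGroup.of (x, z * t) *
      (FreeGroup.of (x, z) * FreeGroup.of (z * x * z⁻¹, z * t * z⁻¹))⁻¹) = 1 :=
    PresentedGroup.one_of_mem (Or.inr ⟨x, z, t, rfl⟩)
  rw [map_mul, map_inv, mul_inv_eq_one, map_mul] at h
  exact h

open scoped commutatorElement in
/-- The map `κ : G ⊗ G → [G, G]`, `x ⊗ y ↦ [x, y] = x y x⁻¹ y⁻¹`. -/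
def kappa (G : Type*) [Group G] : TensorSquare G →* commutator G :=
  PresentedGroup.toGroup
    (f := fun q : G × G =>
      (⟨⁅q.1, q.2⁆, Subgroup.commutator_mem_commutator (Subgroup.mem_top _)
        (Subgroup.mem_top _)⟩ : commutator G)) (by
    rintro r (⟨x, y, z, rfl⟩ | ⟨x, z, t, rfl⟩) <;>
    · apply Subtype.ext
      simp [commutatorElement_def, mul_assoc])

open scoped commutatorElement in
theorem kappa_tmul (x y : G) : ((kappa G (tmul x y) : commutator G) : G) = ⁅x, y⁆ := by
  simp [kappa, tmul]

theorem tmul_conj_tmul (a b c d : G) :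
    tmul a b * tmul c d * (tmul a b)⁻¹ =
      tmul (a * b * a⁻¹ * b⁻¹ * c * (a * b * a⁻¹ * b⁻¹)⁻¹)
        (a * b * a⁻¹ * b⁻¹ * d * (a * b * a⁻¹ * b⁻¹)⁻¹) := by
  have key : ∀ c d : G, tmul (a * b * c * (a * b)⁻¹) (a * b * d * (a * b)⁻¹) * tmul a b =
      tmul a b * tmul (b * a * c * (b * a)⁻¹) (b * a * d * (b * a)⁻¹) := by
    intro c d
    have h1 := mul_tmul a c (b * d)
    rw [tmul_mul a b d,
      show a * (b * d) * a⁻¹ = (a * b * a⁻¹) * (a * d * a⁻¹) by group,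
      tmul_mul (a * c * a⁻¹)] at h1
    have h2 := tmul_mul (a * c) b d
    rw [mul_tmul a c b,
      show b * (a * c) * b⁻¹ = (b * a * b⁻¹) * (b * c * b⁻¹) by group,
      mul_tmul (b * a * b⁻¹)] at h2
    have h3 := h1.symm.trans h2
    simp only [mul_assoc, mul_right_inj, mul_inv_rev, inv_inv, inv_mul_cancel_left] at h3 ⊢
    simp only [← mul_assoc, mul_left_inj] at h3 ⊢
    exact h3
  have h := key ((b * a)⁻¹ * c * (b * a)) ((b * a)⁻¹ * d * (b * a))
  rw [mul_inv_eq_iff_eq_mul]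
  rw [show b * a * ((b * a)⁻¹ * c * (b * a)) * (b * a)⁻¹ = c by group,
    show b * a * ((b * a)⁻¹ * d * (b * a)) * (b * a)⁻¹ = d by group] at h
  rw [← h]
  congr 2 <;> group

theorem conj_tmul (g : TensorSquare G) (c d : G) :
    g * tmul c d * g⁻¹ =
      tmul ((kappa G g : G) * c * (kappa G g : G)⁻¹)
        ((kappa G g : G) * d * (kappa G g : G)⁻¹) := by
  suffices H : ∀ w : FreeGroup (G × G), ∀ c d : G,
      PresentedGroup.mk (tensorSquareRels G) w * tmul c d *
        (PresentedGroup.mk (tensorSquareRels G) w)⁻¹ =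
      tmul ((kappa G (PresentedGroup.mk (tensorSquareRels G) w) : G) * c *
          (kappa G (PresentedGroup.mk (tensorSquareRels G) w) : G)⁻¹)
        ((kappa G (PresentedGroup.mk (tensorSquareRels G) w) : G) * d *
          (kappa G (PresentedGroup.mk (tensorSquareRels G) w) : G)⁻¹) by
    obtain ⟨w, rfl⟩ := PresentedGroup.mk_surjective _ g
    exact H w c d
  intro w
  induction w using FreeGroup.induction_on with
  | C1 => intro c d; simp
  | of q =>
    intro c d
    have h1 := kappa_tmul q.1 q.2
    have h2 := tmul_conj_tmul q.1 q.2 c d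
    rw [← commutatorElement_def, ← h1] at h2
    exact h2
  | inv_of q ih =>
    intro c d
    set u := PresentedGroup.mk (tensorSquareRels G) (FreeGroup.of q) with hu
    have h := ih ((kappa G u : G)⁻¹ * c * (kappa G u : G))
      ((kappa G u : G)⁻¹ * d * (kappa G u : G))
    rw [map_inv, ← hu, map_inv]
    rw [mul_inv_eq_iff_eq_mul] at h
    rw [show ∀ k x : G, k * (k⁻¹ * x * k) * k⁻¹ = x by intros; group,
      show ∀ k x : G, k * (k⁻¹ * x * k) * k⁻¹ = x by intros; group] at h
    simp only [Subgroup.coe_inv, inv_inv]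
    rw [mul_assoc, ← h, inv_mul_cancel_left]
  | mul v w hv hw =>
    intro c d
    have h := hw c d
    have h' := hv _ _ ▸ congrArg (fun z => PresentedGroup.mk (tensorSquareRels G) v * z *
      (PresentedGroup.mk (tensorSquareRels G) v)⁻¹) h
    simp only [map_mul, mul_inv_rev, Subgroup.coe_mul] at h' ⊢
    simpa only [mul_assoc] using h'

end TensorSquare

/-- `J₂(G) = ker κ`. -/
abbrev J2 (G : Type*) [Group G] : Subgroup (TensorSquare G) := (TensorSquare.kappa G).ker

/-- `∇(G)`, the subgroup of `G ⊗ G` generated by the elements `x ⊗ x`. -/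
def nablaSubgroup (G : Type*) [Group G] : Subgroup (TensorSquare G) :=
  Subgroup.closure (Set.range fun x : G => TensorSquare.tmul x x)

instance nablaSubgroup_normal (G : Type*) [Group G] : (nablaSubgroup G).Normal := by
  refine ⟨fun n hn g => ?_⟩
  induction hn using Subgroup.closure_induction with
  | mem x hx =>
    obtain ⟨a, rfl⟩ := hx
    rw [TensorSquare.conj_tmul]
    exact Subgroup.subset_closure ⟨_, rfl⟩
  | one => simp [(nablaSubgroup G).one_mem]
  | mul x y _ _ hx hy =>
    have := (nablaSubgroup G).mul_mem hx hy
    simpa [mul_assoc] using this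
  | inv x _ hx =>
    have := (nablaSubgroup G).inv_mem hx
    simpa [mul_assoc] using this

/-- The nonabelian exterior square `G ∧ G = (G ⊗ G) / ∇(G)`. -/
abbrev ExteriorSquare (G : Type*) [Group G] : Type _ := TensorSquare G ⧸ nablaSubgroup G

/-- The map `κ' : G ∧ G → [G, G]`, `x ∧ y ↦ [x, y]`, induced by `κ`. -/
def kappa' (G : Type*) [Group G] : ExteriorSquare G →* commutator G :=
  QuotientGroup.lift (nablaSubgroup G) (TensorSquare.kappa G) (by
    intro x hx
    have hle : nablaSubgroup G ≤ (TensorSquare.kappa G).ker := by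
      refine (Subgroup.closure_le _).2 ?_
      rintro _ ⟨a, rfl⟩
      refine MonoidHom.mem_ker.2 (Subtype.ext ?_)
      simp [TensorSquare.kappa_tmul]
    exact hle hx)

/-- The Schur multiplier `M(G) = H₂(G) = ker κ'`. -/
abbrev SchurMultiplier (G : Type*) [Group G] : Subgroup (ExteriorSquare G) := (kappa' G).ker

/-! ### The Hirsch length -/

/-- `H` is normal in `K` and `K / H` is infinite cyclic. -/
def IsInfiniteCyclicFactor {G : Type*} [Group G] (H K : Subgroup G) : Prop :=
  H ≤ K ∧ ∃ _ : (H.subgroupOf K).Normal,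
    IsCyclic (K ⧸ H.subgroupOf K) ∧ Infinite (K ⧸ H.subgroupOf K)

/-- `H` is normal in `K` and every element of `K / H` has finite order. -/
def IsPeriodicFactor {G : Type*} [Group G] (H K : Subgroup G) : Prop :=
  H ≤ K ∧ ∃ _ : (H.subgroupOf K).Normal, IsMulTorsion (K ⧸ H.subgroupOf K)

/-- A subnormal series `1 = H₀ ⊴ H₁ ⊴ ⋯ ⊴ H_k = G` each factor of which is infinite cyclic or
periodic. (In a polycyclic group, the series with cyclic factors are of this kind.) -/
structure HirschSeries (G : Type*) [Group G] where
  length : ℕ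
  term : ℕ → Subgroup G
  term_zero : term 0 = ⊥
  term_length : term length = ⊤
  factor : ∀ i < length,
    IsInfiniteCyclicFactor (term i) (term (i + 1)) ∨ IsPeriodicFactor (term i) (term (i + 1))

open scoped Classical in
/-- The number of infinite cyclic factors of the series. -/
noncomputable def HirschSeries.count {G : Type*} [Group G] (s : HirschSeries G) : ℕ :=
  ((Finset.range s.length).filter fun i =>
    IsInfiniteCyclicFactor (s.term i) (s.term (i + 1))).card

/-- The Hirsch length (torsion-free rank) `h(G)`: the number of infinite cyclic factors in a
subnormal series with infinite cyclic or periodic factors. That number is the same for all such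
series of `G`, so taking the infimum amounts to choosing any of them; `h(G) = ⊤` if there is no
such series. -/
noncomputable def hirschLength (G : Type*) [Group G] : ℕ∞ :=
  ⨅ s : HirschSeries G, (s.count : ℕ∞)

/-- `f(h(G)) = h(G ⊗ G) - h(G)`, as an integer; meaningful when both Hirsch lengths are finite. -/
noncomputable def hirschGrowth (G : Type*) [Group G] : ℤ :=
  ((hirschLength (TensorSquare G)).toNat : ℤ) - ((hirschLength G).toNat : ℤ)

/-! ### The crystallographic group of holonomy `n` -/

/-- The `(n-1) × (n-1)` integer matrix with ones just above the diagonal, last row constantly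
`-1`, and zeros elsewhere. -/
def holonomyMatrix (n : ℕ) : Matrix (Fin (n - 1)) (Fin (n - 1)) ℤ :=
  Matrix.of fun i j =>
    if i.val + 1 = n - 1 then -1 else if j.val = i.val + 1 then 1 else 0


/-- `holonomyOrbit n k` is the `k`-th standard basis row vector for `k < n - 1`, and the row vector
with all entries `-1` otherwise. -/
def holonomyOrbit (n k : ℕ) : Fin (n - 1) → ℤ :=
  fun j => if k < n - 1 then (if j.val = k then 1 else 0) else -1

theorem holonomyOrbit_step (n k : ℕ) (hk : k < n) :
    Matrix.vecMul (holonomyOrbit n k) (holonomyMatrix n) = holonomyOrbit n ((k + 1) % n) := by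
  funext j
  have hj := j.isLt
  by_cases h : k < n - 1
  · rw [Nat.mod_eq_of_lt (by omega)]
    have e : holonomyOrbit n k = Pi.single (⟨k, h⟩ : Fin (n - 1)) 1 := by
      funext i
      simp [holonomyOrbit, h, Pi.single_apply, Fin.ext_iff]
    rw [e, Matrix.single_one_vecMul]
    simp only [holonomyMatrix, holonomyOrbit, Matrix.row, Matrix.of_apply]
    split_ifs <;> first | rfl | omega
  · have hkn : k + 1 = n := by omega
    rw [hkn, Nat.mod_self]
    have e : ∀ i : Fin (n - 1), holonomyOrbit n k i * holonomyMatrix n i j =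
        (if i = ⟨n - 2, by omega⟩ then 1 else 0) +
          (if j.val = i.val + 1 then -1 else 0) := by
      intro i
      have hi := i.isLt
      simp only [holonomyMatrix, holonomyOrbit, Matrix.of_apply, h, if_false, Fin.ext_iff]
      split_ifs <;> first | rfl | omega
    simp only [Matrix.vecMul, dotProduct, e, Finset.sum_add_distrib]
    rw [Finset.sum_ite_eq' Finset.univ, if_pos (Finset.mem_univ _)]
    have h0 : 0 < n - 1 := by omega
    by_cases hj0 : j.val = 0
    · simp [hj0, holonomyOrbit, h0]
    · have e2 : ∀ i : Fin (n - 1), (if j.val = i.val + 1 then (-1 : ℤ) else 0) =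
          if i = ⟨j.val - 1, by omega⟩ then -1 else 0 := by
        intro i
        simp only [Fin.ext_iff]
        split_ifs <;> first | rfl | omega
      simp only [e2]
      rw [Finset.sum_ite_eq' Finset.univ, if_pos (Finset.mem_univ _)]
      simp [holonomyOrbit, h0, hj0]

theorem holonomyMatrix_pow (n : ℕ) [NeZero n] : holonomyMatrix n ^ n = 1 := by
  have hn : 0 < n := Nat.pos_of_ne_zero (NeZero.ne n)
  have H : ∀ m k : ℕ, k < n → Matrix.vecMul (holonomyOrbit n k) (holonomyMatrix n ^ m) =
      holonomyOrbit n ((k + m) % n) := by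
    intro m
    induction m with
    | zero => intro k hk; simp [Nat.mod_eq_of_lt hk]
    | succ m ih =>
      intro k hk
      rw [pow_succ, ← Matrix.vecMul_vecMul, ih k hk, holonomyOrbit_step _ _ (Nat.mod_lt _ hn),
        Nat.mod_add_mod, add_assoc]
  ext i j
  have hi := i.isLt
  have h := congrFun (H n i.val (by omega)) j
  have e : holonomyOrbit n i.val = Pi.single i 1 := by
    funext l
    simp [holonomyOrbit, hi, Pi.single_apply, Fin.ext_iff]
  rw [Nat.add_mod_right, Nat.mod_eq_of_lt (by omega), e, Matrix.single_one_vecMul] at h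
  rw [Matrix.one_apply]
  simpa [Pi.single_apply, eq_comm, Matrix.row] using h

/-- The matrix `ξ(t)` as an element of `GL_{n-1}(ℤ)`. -/
def holonomyGL (n : ℕ) [NeZero n] : GL (Fin (n - 1)) ℤ :=
  Units.ofPowEqOne (holonomyMatrix n) n (holonomyMatrix_pow n) (NeZero.ne n)

theorem holonomyGL_pow (n : ℕ) [NeZero n] : holonomyGL n ^ n = 1 :=
  Units.pow_ofPowEqOne (holonomyMatrix_pow n) (NeZero.ne n)

/-- The homomorphism `ξ : C_n → GL_{n-1}(ℤ)` sending the generator `t` to `holonomyGL n`. -/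
def holonomyRep (n : ℕ) [NeZero n] : Multiplicative (ZMod n) →* GL (Fin (n - 1)) ℤ :=
  AddMonoidHom.toMultiplicativeLeft (ZMod.lift n
    ⟨zmultiplesHom (Additive (GL (Fin (n - 1)) ℤ)) (Additive.ofMul (holonomyGL n)), by
      simp [← ofMul_pow, holonomyGL_pow]⟩)

theorem holonomyRep_gen (n : ℕ) [NeZero n] :
    holonomyRep n (Multiplicative.ofAdd 1) = holonomyGL n := by
  have h := ZMod.lift_coe n
    ⟨zmultiplesHom (Additive (GL (Fin (n - 1)) ℤ)) (Additive.ofMul (holonomyGL n)), by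
      simp [← ofMul_pow, holonomyGL_pow]⟩ 1
  simpa [holonomyRep] using congrArg Additive.toMul h

/-- `GL_m(ℤ)` acting on row vectors by `v ↦ v g⁻¹`, as automorphisms of (multiplicative) `ℤ^m`. -/
def rowAction (m : ℕ) : GL (Fin m) ℤ →* MulAut (Multiplicative (Fin m → ℤ)) where
  toFun g := AddEquiv.toMultiplicative
    { toFun := fun v => Matrix.vecMul v (g⁻¹ : GL (Fin m) ℤ).val
      invFun := fun v => Matrix.vecMul v g.val
      left_inv := fun v => by simp [Matrix.vecMul_vecMul]
      right_inv := fun v => by simp [Matrix.vecMul_vecMul]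
      map_add' := fun v w => Matrix.add_vecMul _ v w }
  map_one' := by
    ext v
    simp
  map_mul' g h := by
    ext v
    simp [← Matrix.vecMul_vecMul]

/-- The crystallographic group `G_n = C_n ⋉ ℤ^{n-1}` of holonomy `n`, in which
`t⁻¹ a t = a ξ(t)` for the generator `t` of `C_n` and every row vector `a` of `ℤ^{n-1}`;
so `t⁻¹ a_i t = a_{i+1}` for `i ≤ n - 2` and `t⁻¹ a_{n-1} t = a_1⁻¹ ⋯ a_{n-1}⁻¹`. -/
abbrev CrystalGroup (n : ℕ) [NeZero n] : Type :=
  Multiplicative (Fin (n - 1) → ℤ) ⋊[(rowAction (n - 1)).comp (holonomyRep n)]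
    Multiplicative (ZMod n)

/-! The Hirsch length is additive on extensions, vanishes exactly on periodic groups, and equals `n`
on `ℤⁿ`. Suppose every element of `G` has a positive power that is a single commutator. Then `G /
[G, G]` is periodic, so `h([G, G]) = h(G)`. The same condition makes `∇(G)` periodic: if `xⁿ = [c,
d]`, then `(x ⊗ x)^(n²) = xⁿ ⊗ xⁿ = [c, d] ⊗ [c, d] = 1`, and `∇(G)` is central, being contained in
`J₂(G)`. Since `M(G) = J₂(G) / ∇(G)`, it follows that `h(J₂(G)) = h(M(G))`, and the extension `J₂(G)
→ G ⊗ G → [G, G]` gives `h(G ⊗ G) = h(M(G)) + h(G)`. The crystallographic group meets the condition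
because its holonomy matrix `M` does not have eigenvalue 1. Commutators of lattice elements with
`t⁻¹` fill the image of `M - 1`, which contains `det(M - 1)` times the lattice, and the `n`-th power
of any element lies in the lattice. The given Schur multiplier then yields the numbers. -/

/-! ### Factors of a subnormal series -/

section Factors

variable {G Q : Type*} [Group G] [Group Q] {H K : Subgroup G}

/-- `H` is normal in `K` with cyclic quotient. -/
def IsCyclicFactor (H K : Subgroup G) : Prop :=
  H ≤ K ∧ ∃ _ : (H.subgroupOf K).Normal, IsCyclic (K ⧸ H.subgroupOf K)

theorem isPeriodicFactor_iff : IsPeriodicFactor H K ↔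
    H ≤ K ∧ (H.subgroupOf K).Normal ∧ ∀ k ∈ K, ∃ n, 0 < n ∧ k ^ n ∈ H := by
  refine and_congr_right fun _ => ⟨fun ⟨hn, ht⟩ => ⟨hn, fun k hk => ?_⟩,
    fun ⟨hn, ht⟩ => ⟨hn, fun x => ?_⟩⟩
  · obtain ⟨n, hn0, h⟩ := isOfFinOrder_iff_pow_eq_one.1
      (ht (QuotientGroup.mk' (H.subgroupOf K) ⟨k, hk⟩))
    rw [← map_pow, QuotientGroup.mk'_apply, QuotientGroup.eq_one_iff] at h
    exact ⟨n, hn0, h⟩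
  · obtain ⟨⟨k, hk⟩, rfl⟩ := QuotientGroup.mk'_surjective _ x
    obtain ⟨n, hn0, h⟩ := ht k hk
    refine isOfFinOrder_iff_pow_eq_one.2 ⟨n, hn0, ?_⟩
    rw [← map_pow, QuotientGroup.mk'_apply, QuotientGroup.eq_one_iff]
    exact h

theorem isCyclicFactor_iff : IsCyclicFactor H K ↔
    H ≤ K ∧ (H.subgroupOf K).Normal ∧ ∃ g ∈ K, ∀ k ∈ K, ∃ n : ℤ, (g ^ n)⁻¹ * k ∈ H := by
  refine and_congr_right fun _ => ⟨fun ⟨hn, hc⟩ => ⟨hn, ?_⟩, fun ⟨hn, g, hg, h⟩ => ⟨hn, ?_⟩⟩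
  · obtain ⟨x, hx⟩ := hc.exists_generator
    obtain ⟨⟨g, hg⟩, rfl⟩ := QuotientGroup.mk'_surjective _ x
    refine ⟨g, hg, fun k hk => ?_⟩
    obtain ⟨n, hn⟩ := Subgroup.mem_zpowers_iff.1 (hx (QuotientGroup.mk' _ ⟨k, hk⟩))
    rw [← map_zpow, QuotientGroup.mk'_eq_mk'] at hn
    obtain ⟨z, hz, h⟩ := hn
    refine ⟨n, ?_⟩
    have := congrArg Subtype.val h
    simp only [Subgroup.coe_mul, Subgroup.coe_zpow] at this
    rw [← this, inv_mul_cancel_left]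
    exact hz
  · refine ⟨⟨QuotientGroup.mk' _ ⟨g, hg⟩, fun x => ?_⟩⟩
    obtain ⟨⟨k, hk⟩, rfl⟩ := QuotientGroup.mk'_surjective _ x
    obtain ⟨n, hn⟩ := h k hk
    refine ⟨n, ?_⟩
    simp only
    rw [← map_zpow, QuotientGroup.mk'_eq_mk']
    exact ⟨_, hn, mul_inv_cancel_left _ _⟩

theorem isInfiniteCyclicFactor_iff : IsInfiniteCyclicFactor H K ↔
    IsCyclicFactor H K ∧ ¬ IsPeriodicFactor H K := by
  constructor
  · rintro ⟨hle, hn, hc, hi⟩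
    refine ⟨⟨hle, hn, hc⟩, fun ⟨_, _, ht⟩ => ?_⟩
    obtain ⟨x, hx⟩ := hc.exists_generator
    have h0 := Infinite.orderOf_eq_zero_of_forall_mem_zpowers hx
    exact orderOf_eq_zero_iff.1 h0 (ht x)
  · rintro ⟨⟨hle, hn, hc⟩, hp⟩
    refine ⟨hle, hn, hc, ?_⟩
    by_contra hfin
    have : Finite (K ⧸ H.subgroupOf K) := not_infinite_iff_finite.1 hfin
    exact hp ⟨hle, hn, fun x => isOfFinOrder_of_finite x⟩

/-- An image of an infinite cyclic factor may be finite. Being cyclic or periodic, by contrast,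
survives images and preimages, so series are transported in this form. -/
theorem isInfiniteCyclicFactor_or_isPeriodicFactor_iff :
    IsInfiniteCyclicFactor H K ∨ IsPeriodicFactor H K ↔
      IsCyclicFactor H K ∨ IsPeriodicFactor H K := by
  rw [isInfiniteCyclicFactor_iff]
  tauto

theorem Subgroup.Normal.map_subgroupOf (hle : H ≤ K) (h : (H.subgroupOf K).Normal)
    (f : G →* Q) : ((H.map f).subgroupOf (K.map f)).Normal := by
  rw [Subgroup.normal_subgroupOf_iff hle] at h
  rw [Subgroup.normal_subgroupOf_iff (Subgroup.map_mono hle)]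
  rintro _ _ ⟨x, hx, rfl⟩ ⟨y, hy, rfl⟩
  exact ⟨_, h x y hx hy, by simp⟩

theorem Subgroup.Normal.comap_subgroupOf (hle : H ≤ K) (h : (H.subgroupOf K).Normal)
    (f : Q →* G) : ((H.comap f).subgroupOf (K.comap f)).Normal := by
  rw [Subgroup.normal_subgroupOf_iff hle] at h
  rw [Subgroup.normal_subgroupOf_iff (Subgroup.comap_mono hle)]
  intro x y hx hy
  rw [Subgroup.mem_comap] at *
  simpa using h _ _ hx hy

theorem IsPeriodicFactor.map (h : IsPeriodicFactor H K) (f : G →* Q) :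
    IsPeriodicFactor (H.map f) (K.map f) := by
  rw [isPeriodicFactor_iff] at *
  obtain ⟨hle, hn, ht⟩ := h
  refine ⟨Subgroup.map_mono hle, hn.map_subgroupOf hle f, ?_⟩
  rintro _ ⟨k, hk, rfl⟩
  obtain ⟨n, hn0, h⟩ := ht k hk
  exact ⟨n, hn0, k ^ n, h, map_pow _ _ _⟩

theorem IsPeriodicFactor.comap (h : IsPeriodicFactor H K) (f : Q →* G) :
    IsPeriodicFactor (H.comap f) (K.comap f) := by
  rw [isPeriodicFactor_iff] at *
  obtain ⟨hle, hn, ht⟩ := h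
  refine ⟨Subgroup.comap_mono hle, hn.comap_subgroupOf hle f, fun k hk => ?_⟩
  obtain ⟨n, hn0, h⟩ := ht _ hk
  exact ⟨n, hn0, by simpa using h⟩

theorem IsCyclicFactor.map (h : IsCyclicFactor H K) (f : G →* Q) :
    IsCyclicFactor (H.map f) (K.map f) := by
  rw [isCyclicFactor_iff] at *
  obtain ⟨hle, hn, g, hg, hc⟩ := h
  refine ⟨Subgroup.map_mono hle, hn.map_subgroupOf hle f, f g, ⟨g, hg, rfl⟩, ?_⟩
  rintro _ ⟨k, hk, rfl⟩
  obtain ⟨n, h⟩ := hc k hk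
  exact ⟨n, _, h, by simp⟩

theorem IsCyclicFactor.comap (h : IsCyclicFactor H K) (f : Q →* G) :
    IsCyclicFactor (H.comap f) (K.comap f) := by
  obtain ⟨hle, hn, hc⟩ := h
  have hn' := hn.comap_subgroupOf hle f
  refine ⟨Subgroup.comap_mono hle, hn', ?_⟩
  let φ : K.comap f →* K ⧸ H.subgroupOf K :=
    (QuotientGroup.mk' _).comp ((f.comp (K.comap f).subtype).codRestrict K fun x => x.2)
  have hker : φ.ker = (H.comap f).subgroupOf (K.comap f) := by
    ext x
    rw [MonoidHom.mem_ker]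
    exact QuotientGroup.eq_one_iff _
  let e := QuotientGroup.quotientMulEquivOfEq hker
  have : IsCyclic (K.comap f ⧸ φ.ker) :=
    isCyclic_of_injective (QuotientGroup.kerLift φ) (QuotientGroup.kerLift_injective φ)
  exact isCyclic_of_surjective e e.surjective

/-- In a cyclic factor, if some element of the kernel of `f` has infinite order modulo `H`,
then the image under `f` of the factor is periodic. -/
theorem IsCyclicFactor.isPeriodicFactor_map_or_comap (h : IsCyclicFactor H K) (f : G →* Q) :
    IsPeriodicFactor (H.comap f.ker.subtype) (K.comap f.ker.subtype) ∨
      IsPeriodicFactor (H.map f) (K.map f) := by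
  obtain ⟨hle, hn, hc⟩ := h
  by_contra! hcon
  obtain ⟨h1, h2⟩ := hcon
  apply h1
  rw [isPeriodicFactor_iff] at h2 ⊢
  refine ⟨Subgroup.comap_mono hle, hn.comap_subgroupOf hle _, ?_⟩
  by_contra! hx
  obtain ⟨⟨x, hxf⟩, hxK, hx⟩ := hx
  refine h2 ⟨Subgroup.map_mono hle, hn.map_subgroupOf hle f, ?_⟩
  rintro _ ⟨k, hk, rfl⟩
  obtain ⟨g, hg⟩ := hc.exists_generator
  let q := QuotientGroup.mk' (H.subgroupOf K)
  obtain ⟨m, hm⟩ := Subgroup.mem_zpowers_iff.1 (hg (q ⟨x, hxK⟩))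
  obtain ⟨a, ha⟩ := Subgroup.mem_zpowers_iff.1 (hg (q ⟨k, hk⟩))
  have hm0 : m ≠ 0 := by
    rintro rfl
    have h1 : x ∈ H := (QuotientGroup.eq_one_iff (⟨x, hxK⟩ : K)).1 (hm.symm.trans (zpow_zero g))
    exact hx 1 one_pos (by rw [pow_one]; exact h1)
  -- Modulo `H`, `x` is `g ^ m` and `k` is `g ^ a`, so `x ^ a` and `k ^ m` agree. Since `f` kills
  -- `x`, it sends `k ^ m` into the image of `H`.
  have key : (x ^ a)⁻¹ * k ^ m ∈ H := by
    have : q ((⟨x, hxK⟩ ^ a)⁻¹ * ⟨k, hk⟩ ^ m) = 1 := by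
      rw [map_mul, map_inv, map_zpow, map_zpow, ← hm, ← ha, ← zpow_mul, ← zpow_mul, mul_comm a m,
        inv_mul_cancel]
    exact (QuotientGroup.eq_one_iff (((⟨x, hxK⟩ : K) ^ a)⁻¹ * (⟨k, hk⟩ : K) ^ m)).1 this
  have hfk : f k ^ m ∈ H.map f := ⟨_, key, by simp [MonoidHom.mem_ker.1 hxf]⟩
  refine ⟨m.natAbs, Int.natAbs_pos.2 hm0, ?_⟩
  rcases Int.natAbs_eq m with h | h
  · rwa [h, zpow_natCast] at hfk
  · rw [h, zpow_neg, inv_mem_iff, zpow_natCast] at hfk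
    exact hfk

end Factors

/-! ### Additivity of the Hirsch length -/

namespace HirschSeries

variable {G Q : Type*} [Group G] [Group Q]

theorem isInfiniteCyclicFactor_iff (s : HirschSeries G) {i : ℕ} (hi : i < s.length) :
    IsInfiniteCyclicFactor (s.term i) (s.term (i + 1)) ↔
      ¬ IsPeriodicFactor (s.term i) (s.term (i + 1)) := by
  have := s.factor i hi
  have := _root_.isInfiniteCyclicFactor_iff (H := s.term i) (K := s.term (i + 1))
  tauto

-- Periodicity passes to images and preimages, so counting the non-periodic factors turns
-- comparisons of counts into inclusions of index sets.
open scoped Classical in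
theorem count_eq (s : HirschSeries G) : s.count = ((Finset.range s.length).filter fun i =>
    ¬ IsPeriodicFactor (s.term i) (s.term (i + 1))).card := by
  rw [count]
  congr 1
  exact Finset.filter_congr fun i hi => s.isInfiniteCyclicFactor_iff (Finset.mem_range.1 hi)

/-- The image of a series under a surjective homomorphism. -/
def map (s : HirschSeries G) (f : G →* Q) (hf : Function.Surjective f) : HirschSeries Q where
  length := s.length
  term i := (s.term i).map f
  term_zero := by rw [s.term_zero, Subgroup.map_bot]
  term_length := by rw [s.term_length, Subgroup.map_top_of_surjective f hf]
  factor i hi := by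
    have := s.factor i hi
    rw [isInfiniteCyclicFactor_or_isPeriodicFactor_iff] at *
    exact this.imp (·.map f) (·.map f)

/-- The preimage of a series under an injective homomorphism. -/
def comap (s : HirschSeries G) (f : Q →* G) (hf : Function.Injective f) : HirschSeries Q where
  length := s.length
  term i := (s.term i).comap f
  term_zero := by rw [s.term_zero, MonoidHom.comap_bot, (MonoidHom.ker_eq_bot_iff f).2 hf]
  term_length := by rw [s.term_length, Subgroup.comap_top]
  factor i hi := by
    have := s.factor i hi
    rw [isInfiniteCyclicFactor_or_isPeriodicFactor_iff] at *
    exact this.imp (·.comap f) (·.comap f)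

/-- A factor that is non-periodic in the kernel or in the image is already non-periodic in `s`. No
factor is non-periodic in both, because a cyclic factor cannot contribute infinite order twice. -/
theorem count_comap_add_count_map_le (s : HirschSeries G) (f : G →* Q)
    (hf : Function.Surjective f) :
    (s.comap f.ker.subtype f.ker.subtype_injective).count + (s.map f hf).count ≤ s.count := by
  classical
  rw [count_eq, count_eq, count_eq, ← Finset.card_union_of_disjoint]
  · refine Finset.card_le_card fun i hi => ?_
    rw [Finset.mem_union, Finset.mem_filter, Finset.mem_filter] at hi
    rw [Finset.mem_filter]
    rcases hi with hi | hi
    · exact ⟨hi.1, fun h => hi.2 (h.comap _)⟩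
    · exact ⟨hi.1, fun h => hi.2 (h.map _)⟩
  · rw [Finset.disjoint_left]
    intro i h1 h2
    rw [Finset.mem_filter] at h1 h2
    rcases isInfiniteCyclicFactor_or_isPeriodicFactor_iff.1
      (s.factor i (Finset.mem_range.1 h1.1)) with h | h
    · exact (h.isPeriodicFactor_map_or_comap f).elim h1.2 h2.2
    · exact h1.2 (h.comap _)

/-- A series of the kernel of `f` followed by the preimage of a series of the codomain. -/
def extend (f : G →* Q) (s : HirschSeries f.ker) (r : HirschSeries Q) : HirschSeries G where
  length := s.length + r.length
  term i := if i < s.length then (s.term i).map f.ker.subtype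
    else (r.term (i - s.length)).comap f
  term_zero := by
    split_ifs with h
    · rw [s.term_zero, Subgroup.map_bot]
    · have h0 : s.length = 0 := by omega
      have : (⊤ : Subgroup f.ker) = ⊥ := by rw [← s.term_zero, ← s.term_length, h0]
      rw [Nat.zero_sub, r.term_zero, MonoidHom.comap_bot]
      have h' := congrArg (Subgroup.map f.ker.subtype) this
      rwa [← MonoidHom.range_eq_map, Subgroup.range_subtype, Subgroup.map_bot] at h'
  term_length := by simp [r.term_length]
  factor i hi := by
    rw [isInfiniteCyclicFactor_or_isPeriodicFactor_iff]
    by_cases h : i < s.length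
    -- At the junction `i + 1 = s.length` the two descriptions agree: both give `f.ker`.
    · have e : (if i + 1 < s.length then (s.term (i + 1)).map f.ker.subtype
          else (r.term (i + 1 - s.length)).comap f) = (s.term (i + 1)).map f.ker.subtype := by
        split_ifs with h'
        · rfl
        · have : i + 1 = s.length := by omega
          rw [this, Nat.sub_self, r.term_zero, s.term_length, MonoidHom.comap_bot]
          simp [← MonoidHom.range_eq_map]
      rw [if_pos h, e]
      exact (isInfiniteCyclicFactor_or_isPeriodicFactor_iff.1 (s.factor i h)).imp
        (·.map _) (·.map _)
    · rw [if_neg h, if_neg (by omega), show i + 1 - s.length = i - s.length + 1 by omega]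
      exact (isInfiniteCyclicFactor_or_isPeriodicFactor_iff.1
        (r.factor (i - s.length) (by omega))).imp (·.comap _) (·.comap _)

theorem count_extend_le (f : G →* Q) (s : HirschSeries f.ker) (r : HirschSeries Q) :
    (extend f s r).count ≤ s.count + r.count := by
  classical
  have hlen : (extend f s r).length = s.length + r.length := rfl
  rw [count_eq, hlen, Finset.card_filter, Finset.sum_range_add, ← Finset.card_filter,
    ← Finset.card_filter, s.count_eq, r.count_eq]
  refine add_le_add (Finset.card_le_card fun i hi => ?_) (Finset.card_le_card fun i hi => ?_)
  · simp only [Finset.mem_filter, Finset.mem_range] at hi ⊢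
    refine ⟨hi.1, fun h => hi.2 ?_⟩
    have e : (extend f s r).term (i + 1) = (s.term (i + 1)).map f.ker.subtype := by
      simp only [extend]
      split_ifs with h'
      · rfl
      · have : i + 1 = s.length := by omega
        rw [this, Nat.sub_self, r.term_zero, s.term_length, MonoidHom.comap_bot]
        simp [← MonoidHom.range_eq_map]
    rw [e]
    simp only [extend, if_pos hi.1]
    exact h.map _
  · simp only [Finset.mem_filter, Finset.mem_range] at hi ⊢
    refine ⟨hi.1, fun h => hi.2 ?_⟩
    have := h.comap f
    simpa [extend, add_assoc] using this

end HirschSeries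

section HirschLength

variable {G Q : Type*} [Group G] [Group Q]

/-- The Hirsch length is additive on extensions. -/
theorem hirschLength_eq_ker_add (f : G →* Q) (hf : Function.Surjective f) :
    hirschLength G = hirschLength f.ker + hirschLength Q := by
  apply le_antisymm
  -- No invariance theorem for series is needed: splicing series of kernel and quotient bounds the
  -- infimum above, and splitting a series of `G` bounds it below. Absent series are covered by the
  -- value `⊤`.
  · unfold hirschLength
    exact ENat.le_iInf_add_iInf fun s r => (iInf_le _ (.extend f s r)).trans
      (by exact_mod_cast HirschSeries.count_extend_le f s r)
  · refine le_iInf fun s => ?_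
    refine (add_le_add (iInf_le _ (s.comap f.ker.subtype f.ker.subtype_injective))
      (iInf_le _ (s.map f hf))).trans ?_
    exact_mod_cast s.count_comap_add_count_map_le f hf

/-- The one-step series `1 ⊴ G`. -/
def HirschSeries.ofFactor
    (h : IsInfiniteCyclicFactor (⊥ : Subgroup G) ⊤ ∨ IsPeriodicFactor (⊥ : Subgroup G) ⊤) :
    HirschSeries G where
  length := 1
  term i := if i = 0 then ⊥ else ⊤
  term_zero := rfl
  term_length := rfl
  factor i hi := by
    obtain rfl : i = 0 := by omega
    exact h

/-! ### Hirsch lengths of periodic, cyclic and free abelian groups. -/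

theorem isPeriodicFactor_bot_top (h : IsMulTorsion G) :
    IsPeriodicFactor (⊥ : Subgroup G) ⊤ :=
  isPeriodicFactor_iff.2 ⟨bot_le, Subgroup.normal_comap _, fun k _ => by
    simpa using isOfFinOrder_iff_pow_eq_one.1 (h k)⟩

theorem hirschLength_eq_zero_iff : hirschLength G = 0 ↔ IsMulTorsion G := by
  classical
  constructor
  · intro h
    obtain ⟨s, hs⟩ := ENat.iInf_eq_zero.1 h
    rw [Nat.cast_eq_zero, s.count_eq, Finset.card_eq_zero, Finset.filter_eq_empty_iff] at hs
    -- Climbing a series whose factors are all periodic: some power of `k` lies one term lower.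
    have key : ∀ i ≤ s.length, ∀ k ∈ s.term i, IsOfFinOrder k := by
      intro i
      induction i with
      | zero =>
        intro _ k hk
        rw [s.term_zero, Subgroup.mem_bot] at hk
        exact hk ▸ IsOfFinOrder.one
      | succ i ih =>
        intro hi k hk
        obtain ⟨n, hn, hkn⟩ := (isPeriodicFactor_iff.1
          (not_not.1 (hs (Finset.mem_range.2 hi)))).2.2 k hk
        exact (ih (by omega) _ hkn).of_pow hn.ne'
    exact fun g => key s.length le_rfl g (s.term_length ▸ Subgroup.mem_top g)
  · intro h
    refine ENat.iInf_eq_zero.2 ⟨.ofFactor (Or.inr (isPeriodicFactor_bot_top h)), ?_⟩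
    rw [Nat.cast_eq_zero, HirschSeries.count_eq, Finset.card_eq_zero, Finset.filter_eq_empty_iff]
    intro i hi
    obtain rfl : i = 0 := Nat.lt_one_iff.1 (Finset.mem_range.1 hi)
    exact not_not.2 (isPeriodicFactor_bot_top h)

theorem hirschLength_eq_one_of_isCyclic [hc : IsCyclic G] (h : ¬ IsMulTorsion G) :
    hirschLength G = 1 := by
  classical
  refine le_antisymm ?_ (Order.one_le_iff_ne_zero.2 fun h0 => h (hirschLength_eq_zero_iff.1 h0))
  have hf : IsCyclicFactor (⊥ : Subgroup G) ⊤ := by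
    obtain ⟨g, hg⟩ := hc.exists_generator
    refine isCyclicFactor_iff.2 ⟨bot_le, Subgroup.normal_comap _, g, Subgroup.mem_top g,
      fun k _ => ?_⟩
    obtain ⟨n, rfl⟩ := Subgroup.mem_zpowers_iff.1 (hg k)
    exact ⟨n, by simp⟩
  refine (iInf_le _ (.ofFactor
    (isInfiniteCyclicFactor_or_isPeriodicFactor_iff.2 (Or.inl hf)))).trans ?_
  exact_mod_cast (Finset.card_filter_le _ _).trans (Finset.card_range _).le

theorem MulEquiv.hirschLength_eq (e : G ≃* Q) : hirschLength G = hirschLength Q := by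
  rw [hirschLength_eq_ker_add e.toMonoidHom e.surjective, hirschLength_eq_zero_iff.2, zero_add]
  rintro ⟨x, hx⟩
  obtain rfl : x = 1 := e.injective (by simpa using hx)
  exact IsOfFinOrder.one

theorem hirschLength_multiplicative_pi_int (n : ℕ) :
    hirschLength (Multiplicative (Fin n → ℤ)) = n := by
  induction n with
  | zero =>
    refine hirschLength_eq_zero_iff.2 fun x => ?_
    rw [Subsingleton.elim x 1]
    exact IsOfFinOrder.one
  | succ n ih =>
    -- `f` forgets coordinate 0. Its kernel embeds in `ℤ` through that coordinate, hence is cyclic,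
    -- and it contains the first basis vector, which has infinite order.
    let f : Multiplicative (Fin (n + 1) → ℤ) →* Multiplicative (Fin n → ℤ) :=
      AddMonoidHom.toMultiplicative (LinearMap.funLeft ℤ ℤ Fin.succ).toAddMonoidHom
    let c : Multiplicative (Fin (n + 1) → ℤ) →* Multiplicative ℤ :=
      AddMonoidHom.toMultiplicative (Pi.evalAddMonoidHom (fun _ : Fin (n + 1) => ℤ) 0)
    have hf : Function.Surjective f := fun y =>
      ⟨Multiplicative.ofAdd (Fin.cons 0 y.toAdd), rfl⟩
    have hker : ∀ x : f.ker, ∀ i : Fin n, x.1.toAdd i.succ = 0 := fun x i =>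
      congrFun (congrArg Multiplicative.toAdd (MonoidHom.mem_ker.1 x.2)) i
    have hc : Function.Injective (c.comp f.ker.subtype) := by
      intro x y hxy
      refine Subtype.ext (Multiplicative.toAdd.injective (funext fun i => ?_))
      refine Fin.cases ?_ (fun i => ?_) i
      · exact congrArg Multiplicative.toAdd hxy
      · rw [hker, hker]
    have : IsCyclic f.ker := isCyclic_of_injective _ hc
    rw [hirschLength_eq_ker_add f hf, ih, hirschLength_eq_one_of_isCyclic, add_comm]
    · push_cast; rfl
    · intro ht
      let x : f.ker := ⟨Multiplicative.ofAdd (Fin.cons 1 0), rfl⟩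
      have hx := (c.comp f.ker.subtype).isOfFinOrder (ht x)
      obtain ⟨m, hm, h⟩ := isOfFinOrder_iff_pow_eq_one.1 hx
      have h' := congrArg Multiplicative.toAdd h
      rw [toAdd_pow] at h'
      have : (m : ℤ) * 1 = 0 := by simpa [c, x] using h'
      omega

end HirschLength

/-! ### The subgroup `∇(G)` -/

namespace TensorSquare

variable {G : Type*} [Group G]

theorem tmul_one (x : G) : tmul x 1 = 1 := by
  have h := tmul_mul x 1 1
  simpa using h

theorem one_tmul (x : G) : tmul 1 x = 1 := by
  have h := mul_tmul 1 1 x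
  simpa using h

theorem tmul_inv (x y : G) : tmul x y⁻¹ = (tmul (y⁻¹ * x * y) y)⁻¹ := by
  have h := tmul_mul x y⁻¹ y
  rw [inv_mul_cancel, tmul_one] at h
  simpa using eq_inv_of_mul_eq_one_left h.symm

open scoped commutatorElement in
/-- `g ⊗ [c, d] = ᵍ(c ⊗ d) (c ⊗ d)⁻¹`. -/
theorem tmul_commutatorElement (g c d : G) :
    tmul g ⁅c, d⁆ = tmul (g * c * g⁻¹) (g * d * g⁻¹) * (tmul c d)⁻¹ := by
  -- Expand `g ⊗ (cdc⁻¹)d⁻¹`; the second factor is `(g ⊗ d)⁻¹` conjugated by `[c, d]`, which is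
  -- conjugation by `c ⊗ d`. The factor `g ⊗ cdc⁻¹` then comes from two expansions of `gc ⊗ d`.
  have h1 : tmul g ⁅c, d⁆ = tmul g (c * d * c⁻¹) * (tmul c d * (tmul g d)⁻¹ * (tmul c d)⁻¹) := by
    have e : tmul c d * (tmul g d)⁻¹ * (tmul c d)⁻¹ =
        (tmul c d * tmul g d * (tmul c d)⁻¹)⁻¹ := by group
    rw [e, tmul_conj_tmul, commutatorElement_def, tmul_mul g (c * d * c⁻¹) d⁻¹]
    congr 1
    rw [show c * d * c⁻¹ * d⁻¹ * (c * d * c⁻¹)⁻¹ =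
        (c * d * c⁻¹ * d * (c * d * c⁻¹)⁻¹)⁻¹ by group, tmul_inv]
    congr 2 <;> group
  have h2 : tmul (g * c) d = tmul g (c * d * c⁻¹) * tmul c d := by
    have := mul_tmul c (c⁻¹ * g * c) d
    rwa [show c * (c⁻¹ * g * c) = g * c by group,
      show g * c * c⁻¹ = g by group] at this
  have h3 := mul_tmul g c d
  rw [h2] at h3
  rw [h1, ← mul_assoc, ← mul_assoc, h3]
  group

-- For `g = [c, d]`, the action of `g` on `c ⊗ d` is conjugation of `c ⊗ d` by itself.
open scoped commutatorElement in
theorem commutatorElement_tmul_self (c d : G) : tmul ⁅c, d⁆ ⁅c, d⁆ = 1 := by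
  rw [tmul_commutatorElement, commutatorElement_def, ← tmul_conj_tmul]
  group

theorem tmul_pow {x y : G} (h : Commute x y) (n : ℕ) : tmul x (y ^ n) = tmul x y ^ n := by
  induction n with
  | zero => simp [tmul_one]
  | succ n ih =>
    have := h.pow_right n
    rw [pow_succ, tmul_mul, ih, pow_succ, ← this.eq, mul_inv_cancel_right, ← pow_succ, pow_succ',
      mul_inv_cancel_right]

theorem pow_tmul {x y : G} (h : Commute x y) (n : ℕ) : tmul (x ^ n) y = tmul x y ^ n := by
  induction n with
  | zero => simp [one_tmul]
  | succ n ih =>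
    have := h.pow_left n
    rw [pow_succ, mul_tmul, ih, pow_succ', this.eq, mul_inv_cancel_right, ← pow_succ, pow_succ',
      mul_inv_cancel_right]

theorem pow_tmul_pow_self (x : G) (n : ℕ) : tmul (x ^ n) (x ^ n) = tmul x x ^ (n * n) := by
  rw [pow_tmul ((Commute.refl x).pow_right n), tmul_pow (Commute.refl x), pow_mul]

/-- Conjugation by `z` acts on the generating symbols through `κ(z)`, which is trivial on `J₂(G)`.
-/
theorem J2_le_center : J2 G ≤ Subgroup.center (TensorSquare G) := by
  intro z hz
  have hz' : kappa G z = 1 := hz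
  rw [Subgroup.mem_center_iff]
  intro g
  have : Subgroup.closure (Set.range (PresentedGroup.of (rels := tensorSquareRels G))) ≤
      Subgroup.centralizer {z} := by
    rw [Subgroup.closure_le]
    rintro _ ⟨⟨c, d⟩, rfl⟩
    have h := conj_tmul z c d
    rw [hz'] at h
    simp only [Subgroup.coe_one, one_mul, inv_one, mul_one] at h
    exact Subgroup.mem_centralizer_singleton_iff.2 (mul_inv_eq_iff_eq_mul.1 h).symm
  rw [PresentedGroup.closure_range_of] at this
  exact Subgroup.mem_centralizer_singleton_iff.1 (this (Subgroup.mem_top g))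

theorem kappa_surjective : Function.Surjective (kappa G) := by
  rw [← MonoidHom.range_eq_top, eq_top_iff]
  have h : commutator G ≤ (kappa G).range.map (commutator G).subtype :=
    (commutator_def G).le.trans (Subgroup.commutator_le.2 fun x _ y _ =>
      ⟨kappa G (tmul x y), ⟨_, rfl⟩, kappa_tmul x y⟩)
  intro x _
  obtain ⟨y, hy, hxy⟩ := h x.2
  obtain rfl : y = x := Subtype.ext hxy
  exact hy

end TensorSquare

theorem nablaSubgroup_le_J2 (G : Type*) [Group G] : nablaSubgroup G ≤ J2 G := by
  refine (Subgroup.closure_le _).2 ?_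
  rintro _ ⟨a, rfl⟩
  refine MonoidHom.mem_ker.2 (Subtype.ext ?_)
  simp [TensorSquare.kappa_tmul]

open scoped commutatorElement in
/-- `∇(G)` is periodic if some power of every element of `G` is a commutator. -/
theorem isOfFinOrder_of_mem_nablaSubgroup {G : Type*} [Group G]
    (h : ∀ x : G, ∃ n, 0 < n ∧ ∃ c d : G, x ^ n = ⁅c, d⁆)
    {z : TensorSquare G} (hz : z ∈ nablaSubgroup G) : IsOfFinOrder z := by
  have hc : nablaSubgroup G ≤ Subgroup.center (TensorSquare G) :=
    (nablaSubgroup_le_J2 G).trans TensorSquare.J2_le_center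
  induction hz using Subgroup.closure_induction with
  | mem x hx =>
    obtain ⟨a, rfl⟩ := hx
    obtain ⟨n, hn, c, d, e⟩ := h a
    refine isOfFinOrder_iff_pow_eq_one.2 ⟨n * n, Nat.mul_pos hn hn, ?_⟩
    rw [← TensorSquare.pow_tmul_pow_self, e, TensorSquare.commutatorElement_tmul_self]
  | one => exact IsOfFinOrder.one
  | mul x y hx _ ihx ihy =>
    exact Commute.isOfFinOrder_mul (Subgroup.mem_center_iff.1 (hc hx) y).symm ihx ihy
  | inv x _ ih => exact ih.inv

/-! ### Commutators in the crystallographic group -/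

section CrystalGroup

theorem vecMul_holonomyMatrix (n : ℕ) (v : Fin (n - 1) → ℤ) (j : Fin (n - 1)) :
    Matrix.vecMul v (holonomyMatrix n) j =
      -v ⟨n - 2, by have := j.isLt; omega⟩ + if h : 0 < j.val then v ⟨j.val - 1, by have := j.isLt; omega⟩ else 0 := by
  have hj := j.isLt
  have e : ∀ i : Fin (n - 1), v i * holonomyMatrix n i j =
      (if i = ⟨n - 2, by omega⟩ then -v i else 0) + (if j.val = i.val + 1 then v i else 0) := by
    intro i
    have hi := i.isLt
    simp only [holonomyMatrix, Matrix.of_apply, Fin.ext_iff]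
    split_ifs <;> omega
  simp only [Matrix.vecMul, dotProduct, e, Finset.sum_add_distrib]
  rw [Finset.sum_ite_eq' Finset.univ, if_pos (Finset.mem_univ _)]
  congr 1
  split_ifs with h
  · have e2 : ∀ i : Fin (n - 1), (if j.val = i.val + 1 then v i else 0) =
        if i = ⟨j.val - 1, by omega⟩ then v i else 0 := by
      intro i
      simp only [Fin.ext_iff]
      split_ifs <;> first | rfl | omega
    simp only [e2]
    rw [Finset.sum_ite_eq' Finset.univ, if_pos (Finset.mem_univ _)]
  · exact Finset.sum_eq_zero fun i _ => if_neg (by omega)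

/-- Solving the fixed-point equation coordinate by coordinate expresses `v` through its last entry
`c`. At the last index this reads `c = -(n - 1)c`, so `nc = 0`. -/
theorem eq_zero_of_vecMul_holonomyMatrix_eq (n : ℕ) {v : Fin (n - 1) → ℤ}
    (h : Matrix.vecMul v (holonomyMatrix n) = v) : v = 0 := by
  funext j
  have hj := j.isLt
  set c := v ⟨n - 2, by omega⟩ with hc
  have key : ∀ k (hk : k < n - 1), v ⟨k, hk⟩ = -((k : ℤ) + 1) * c := by
    intro k
    induction k with
    | zero =>
      intro hk
      have := congrFun h ⟨0, hk⟩
      rw [vecMul_holonomyMatrix] at this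
      simp only [lt_irrefl, dif_neg, not_false_eq_true] at this
      rw [← this]; push_cast; ring
    | succ k ih =>
      intro hk
      have := congrFun h ⟨k + 1, hk⟩
      rw [vecMul_holonomyMatrix, dif_pos (Nat.succ_pos k)] at this
      simp only [Nat.add_sub_cancel, ih (by omega)] at this
      rw [← this]; push_cast; ring
  have hlast := key (n - 2) (by omega)
  rw [← hc] at hlast
  -- The factor is `n`: the existence of the index `j` forces `n ≥ 2`, so the truncated subtraction
  -- is exact.
  have hmul : ((n - 2 : ℕ) + 2 : ℤ) * c = 0 := by linarith
  have hc0 : c = 0 := by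
    rcases mul_eq_zero.1 hmul with h' | h'
    · omega
    · exact h'
  have := key j.val hj
  rw [hc0, mul_zero] at this
  exact this

theorem det_holonomyMatrix_sub_one_ne_zero (n : ℕ) : (holonomyMatrix n - 1).det ≠ 0 := by
  intro h
  obtain ⟨v, hv0, hv⟩ := Matrix.exists_vecMul_eq_zero_iff.2 h
  rw [Matrix.vecMul_sub, Matrix.vecMul_one, sub_eq_zero] at hv
  exact hv0 (eq_zero_of_vecMul_holonomyMatrix_eq n hv)

variable (n : ℕ) [NeZero n]

open scoped commutatorElement in
/-- `[-w, t⁻¹] = wM - w` in `CrystalGroup n`, where `M` is the holonomy matrix. -/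
theorem commutatorElement_inl_inr (w : Fin (n - 1) → ℤ) :
    ⁅(SemidirectProduct.inl (Multiplicative.ofAdd (-w)) : CrystalGroup n),
      (SemidirectProduct.inr (Multiplicative.ofAdd (1 : ZMod n))⁻¹ : CrystalGroup n)⁆ =
      SemidirectProduct.inl (Multiplicative.ofAdd
        (Matrix.vecMul w (holonomyMatrix n - 1))) := by
  -- `rowAction` multiplies by the inverse matrix, so it is `t⁻¹` that acts by the holonomy matrix
  -- itself.
  have key : (((rowAction (n - 1)).comp (holonomyRep n)) (Multiplicative.ofAdd (1 : ZMod n))⁻¹)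
      (Multiplicative.ofAdd w) = Multiplicative.ofAdd (Matrix.vecMul w (holonomyMatrix n)) := by
    rw [map_inv, MonoidHom.comp_apply, holonomyRep_gen, ← map_inv]
    change Multiplicative.ofAdd (Matrix.vecMul w ((holonomyGL n)⁻¹⁻¹).val) = _
    rw [inv_inv]
    rfl
  rw [commutatorElement_def, ← map_inv SemidirectProduct.inl, ofAdd_neg, inv_inv, mul_assoc,
    mul_assoc, ← mul_assoc (SemidirectProduct.inr _), ← map_inv SemidirectProduct.inr,
    ← SemidirectProduct.inl_aut, key, ← map_mul, ← ofAdd_neg, ← ofAdd_add, neg_add_eq_sub,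
    Matrix.vecMul_sub, Matrix.vecMul_one]

open scoped commutatorElement in
theorem exists_pow_eq_commutatorElement (x : CrystalGroup n) :
    ∃ m, 0 < m ∧ ∃ c d : CrystalGroup n, x ^ m = ⁅c, d⁆ := by
  set D := (holonomyMatrix n - 1).det with hD
  have hD0 : D ≠ 0 := det_holonomyMatrix_sub_one_ne_zero n
  have hn : 0 < n := Nat.pos_of_ne_zero (NeZero.ne n)
  have hx : (x ^ n).right = 1 := by
    rw [← SemidirectProduct.rightHom_eq_right, map_pow]
    apply Multiplicative.toAdd.injective
    simp
  obtain ⟨v, hv⟩ : ∃ v : Fin (n - 1) → ℤ,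
      x ^ n = SemidirectProduct.inl (Multiplicative.ofAdd v) :=
    ⟨(x ^ n).left.toAdd, SemidirectProduct.ext rfl hx⟩
  -- With `xⁿ = v` in the lattice, the adjugate solves `w(M - 1) = |D|v` over `ℤ`. The factor
  -- `D.sign` turns `D` into `|D|`, and the minus sign matches the commutator formula, whose entry
  -- is `-w`.
  refine ⟨n * D.natAbs, Nat.mul_pos hn (Int.natAbs_pos.2 hD0),
    SemidirectProduct.inl (Multiplicative.ofAdd
      (-Matrix.vecMul (D.sign • v) (holonomyMatrix n - 1).adjugate)),
    SemidirectProduct.inr (Multiplicative.ofAdd (1 : ZMod n))⁻¹, ?_⟩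
  rw [commutatorElement_inl_inr, Matrix.vecMul_vecMul, Matrix.adjugate_mul, ← hD, pow_mul, hv,
    ← map_pow, ← ofAdd_nsmul, Matrix.vecMul_smul, Matrix.vecMul_one, smul_smul,
    Int.mul_sign_self, natCast_zsmul]

end CrystalGroup

/-! ### The Hirsch lengths of `J₂(G)` and `G ⊗ G` -/

theorem hirschLength_crystalGroup (n : ℕ) [NeZero n] :
    hirschLength (CrystalGroup n) = ((n - 1 : ℕ) : ℕ∞) := by
  rw [hirschLength_eq_ker_add SemidirectProduct.rightHom SemidirectProduct.rightHom_surjective,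
    (hirschLength_eq_zero_iff (G := Multiplicative (ZMod n))).2 fun x => isOfFinOrder_of_finite x,
    add_zero,
    ← hirschLength_multiplicative_pi_int]
  rw [← SemidirectProduct.range_inl_eq_ker_rightHom]
  exact (MonoidHom.ofInjective SemidirectProduct.inl_injective).hirschLength_eq.symm

-- The abelianization is periodic under `h`, so it contributes nothing.
open scoped commutatorElement in
theorem hirschLength_commutator {G : Type*} [Group G]
    (h : ∀ x : G, ∃ n, 0 < n ∧ ∃ c d : G, x ^ n = ⁅c, d⁆) :
    hirschLength (commutator G) = hirschLength G := by
  rw [hirschLength_eq_ker_add (QuotientGroup.mk' (commutator G)) (QuotientGroup.mk'_surjective _),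
    (hirschLength_eq_zero_iff (G := G ⧸ commutator G)).2, add_zero, QuotientGroup.ker_mk']
  intro x
  obtain ⟨x, rfl⟩ := QuotientGroup.mk'_surjective _ x
  obtain ⟨n, hn, c, d, e⟩ := h x
  refine isOfFinOrder_iff_pow_eq_one.2 ⟨n, hn, ?_⟩
  rw [← map_pow, e]
  exact (QuotientGroup.eq_one_iff _).2
    (Subgroup.commutator_mem_commutator (Subgroup.mem_top _) (Subgroup.mem_top _))

-- The quotient map restricts to a surjection `J₂(G) → M(G)` whose kernel consists of elements of
-- the periodic group `∇(G)`.
open scoped commutatorElement in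
theorem hirschLength_J2 {G : Type*} [Group G]
    (h : ∀ x : G, ∃ n, 0 < n ∧ ∃ c d : G, x ^ n = ⁅c, d⁆) :
    hirschLength (J2 G) = hirschLength (SchurMultiplier G) := by
  let f : J2 G →* SchurMultiplier G :=
    ((QuotientGroup.mk' (nablaSubgroup G)).comp (J2 G).subtype).codRestrict _ fun x => x.2
  have hf : Function.Surjective f := by
    rintro ⟨y, hy⟩
    obtain ⟨x, rfl⟩ := QuotientGroup.mk'_surjective _ y
    exact ⟨⟨x, hy⟩, rfl⟩
  rw [hirschLength_eq_ker_add f hf, (hirschLength_eq_zero_iff (G := f.ker)).2, zero_add]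
  intro x
  have hx : (x.1.1 : TensorSquare G) ∈ nablaSubgroup G :=
    (QuotientGroup.eq_one_iff _).1 (congrArg Subtype.val (MonoidHom.mem_ker.1 x.2))
  rw [← Submonoid.isOfFinOrder_coe, ← Submonoid.isOfFinOrder_coe]
  exact isOfFinOrder_of_mem_nablaSubgroup h hx

open scoped commutatorElement in
theorem hirschLength_tensorSquare {G : Type*} [Group G]
    (h : ∀ x : G, ∃ n, 0 < n ∧ ∃ c d : G, x ^ n = ⁅c, d⁆) :
    hirschLength (TensorSquare G) = hirschLength (SchurMultiplier G) + hirschLength G := by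
  rw [hirschLength_eq_ker_add (TensorSquare.kappa G) TensorSquare.kappa_surjective,
    hirschLength_commutator h, hirschLength_J2 h]

theorem corollaryc
    (hM : ∀ (p : ℕ) [Fact p.Prime], p ≠ 2 →
      Nonempty (SchurMultiplier (CrystalGroup p) ≃*
        Multiplicative (Fin ((p - 1) / 2) → ℤ))) :
    ∀ (p : ℕ) [Fact p.Prime], p ≠ 2 →
      -- the Hirsch lengths entering `f(h(G_p)) = h(G_p ⊗ G_p) - h(G_p)` are finite
      hirschLength (CrystalGroup p) = ((p - 1 : ℕ) : ℕ∞) ∧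
      hirschLength (TensorSquare (CrystalGroup p)) ≠ ⊤ ∧
      -- `f(h(G_p)) = (p - 1) / 2 = h(J₂(G_p)) = h(M(G_p))`
      (hirschGrowth (CrystalGroup p) : ℚ) = ((p : ℚ) - 1) / 2 ∧
      hirschLength (J2 (CrystalGroup p)) = (((p - 1) / 2 : ℕ) : ℕ∞) ∧
      hirschLength (SchurMultiplier (CrystalGroup p)) = (((p - 1) / 2 : ℕ) : ℕ∞) ∧
      -- linear growth in `h(G_p)`
      (hirschGrowth (CrystalGroup p) : ℚ) =
        (1 / 2) * ((hirschLength (CrystalGroup p)).toNat : ℚ) := by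

  intro p hp hp2
  have hprime := hp.out
  obtain ⟨e⟩ := hM p hp2
  have hcomm := exists_pow_eq_commutatorElement p
  have hG := hirschLength_crystalGroup p
  have hMp : hirschLength (SchurMultiplier (CrystalGroup p)) = (((p - 1) / 2 : ℕ) : ℕ∞) :=
    e.hirschLength_eq.trans (hirschLength_multiplicative_pi_int _)
  have hT : hirschLength (TensorSquare (CrystalGroup p)) =
      (((p - 1) / 2 + (p - 1) : ℕ) : ℕ∞) := by
    rw [hirschLength_tensorSquare hcomm, hMp, hG, Nat.cast_add]
  have hgrowth : (hirschGrowth (CrystalGroup p) : ℚ) = ((p : ℚ) - 1) / 2 := by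
    -- Oddness makes the natural-number quotient `(p - 1) / 2` exact, so it agrees with the rational
    -- one.
    obtain ⟨k, hk⟩ := hprime.odd_of_ne_two hp2
    have h1 : (p - 1) / 2 = k := by omega
    have h2 : p - 1 = 2 * k := by omega
    rw [hirschGrowth, hT, hG, ENat.toNat_natCast, ENat.toNat_natCast, h1, h2, hk]
    push_cast
    ring
  refine ⟨hG, hT ▸ ENat.natCast_ne_top _, hgrowth, (hirschLength_J2 hcomm).trans hMp, hMp, ?_⟩
  rw [hgrowth, hG, ENat.toNat_natCast, Nat.cast_sub hprime.one_le]
  push_cast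
  ring
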